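/- Notation. For a set $S\subset\mathbb R^m$, $S^c$ and $\partial S$ denote complement and boundary, $|\cdot|$ is the Euclidean norm, and for non-empty sets $$d_H(A,B)=\max\Big\{\sup_{a\in A}\inf_{b\in B}|a-b|,\ \sup_{b\in B}\inf_{a\in A}|a-b|\Big\}$$ is the Hausdorff distance. For a bounded $C^1$ vector field $\chi$ on $\mathbb R^m$, $t\mapsto Z(z,t)$ ($t\in\mathbb R$) denotes the unique solution of $\dot z=\chi(z)$ with $Z(z,0)=z$. An open set $E\subset\mathbb R^m$ verifies condition $\mathbb B$ with the vector field $\chi$ if $\chi$ is bounded and $C^1$ and there exist a $C^1$ function $\kappa:\mathbb R^m\to\mathbb R$ and a closed set $K_0$ contained in $E$ such that 1. $E=\{z\in\mathbb R^m:\kappa(z)<0\}$; 2. $K_0$ is globally attractive for $\chi$: for every $z\in\mathbb R^m$ and every open set $U\supseteq K_0$ there is $T$ with $Z(z,t)\in U$ for all $t\ge T$; 3. $\frac{\partial\kappa}{\partial z}(z)\,\chi(z)<0$ for all $z\in\mathbb R^m$ with $\kappa(z)=0$. Lemma. Let $s\in\{1,2,\dots\}\cup\{\infty\}$ and let $E\subsetneq\mathbb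 R^m$ be an open set verifying condition $\mathbb B$ with a $C^s$ vector field $\chi$. For every $\varepsilon>0$ put $$\Sigma=\bigcup_{t\in[0,\varepsilon]}Z(\partial E,t),\qquad E_\varepsilon=E\cap\Sigma^c .$$ Then there exists a $C^s$-diffeomorphism $\phi$ from $\mathbb R^m$ onto $E$ such that, for every $z\in\mathbb R^m$, $\phi(z)$ lies on the trajectory of $\chi$ through $z$, and $\phi(z)=z$ for all $z\in E_\varepsilon$. Moreover $$d_H(\partial E_\varepsilon,\partial E)\le\varepsilon\,\sup_{z\in\mathbb R^m}|\chi(z)| .$$ -/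

import Mathlib

/-- `FlowsTo χ t x y`: the (unique) solution of `ż = χ z` which is at `x` at time `0` is defined
for all times and is at `y` at time `t`, i.e. `y = Z(x, t)`. -/
def FlowsTo {m : ℕ} (χ : EuclideanSpace ℝ (Fin m) → EuclideanSpace ℝ (Fin m)) (t : ℝ)
    (x y : EuclideanSpace ℝ (Fin m)) : Prop :=
  ∃ γ : ℝ → EuclideanSpace ℝ (Fin m), IsIntegralCurve γ (fun _ => χ) ∧ γ 0 = x ∧ γ t = y

/-- The closed set `K` is globally attractive for `χ`: every solution ultimately stays in every
neighbourhood of `K`. (The vector field is meant to be complete.) -/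
def GloballyAttractive {m : ℕ} (χ : EuclideanSpace ℝ (Fin m) → EuclideanSpace ℝ (Fin m))
    (K : Set (EuclideanSpace ℝ (Fin m))) : Prop :=
  ∀ γ : ℝ → EuclideanSpace ℝ (Fin m), IsIntegralCurve γ (fun _ => χ) →
    ∀ U : Set (EuclideanSpace ℝ (Fin m)), IsOpen U → K ⊆ U → ∀ᶠ t in Filter.atTop, γ t ∈ U

/-- The set `E` verifies condition `𝔹` with the vector field `χ`. -/
def ConditionB {m : ℕ} (E : Set (EuclideanSpace ℝ (Fin m)))
    (χ : EuclideanSpace ℝ (Fin m) → EuclideanSpace ℝ (Fin m)) : Prop :=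
  ContDiff ℝ 1 χ ∧ (∃ C : ℝ, ∀ z, ‖χ z‖ ≤ C) ∧
  ∃ (κ : EuclideanSpace ℝ (Fin m) → ℝ) (K₀ : Set (EuclideanSpace ℝ (Fin m))),
    ContDiff ℝ 1 κ ∧ IsClosed K₀ ∧ K₀ ⊆ E ∧
    E = {z | κ z < 0} ∧
    GloballyAttractive χ K₀ ∧
    ∀ z, κ z = 0 → fderiv ℝ κ z (χ z) < 0

/-- The flow layer `Σ = ⋃_{t ∈ [0, ε]} Z(∂E, t)`. -/
def flowLayer {m : ℕ} (E : Set (EuclideanSpace ℝ (Fin m)))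
    (χ : EuclideanSpace ℝ (Fin m) → EuclideanSpace ℝ (Fin m)) (ε : ℝ) :
    Set (EuclideanSpace ℝ (Fin m)) :=
  {z | ∃ t ∈ Set.Icc 0 ε, ∃ x ∈ frontier E, FlowsTo χ t x z}

/-- The set `E_ε = E ∩ Σᶜ`. -/
def innerSet {m : ℕ} (E : Set (EuclideanSpace ℝ (Fin m)))
    (χ : EuclideanSpace ℝ (Fin m) → EuclideanSpace ℝ (Fin m)) (ε : ℝ) :
    Set (EuclideanSpace ℝ (Fin m)) :=
  E ∩ (flowLayer E χ ε)ᶜ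

/-- `φ` is a `C^s` diffeomorphism from the whole space onto the (open) set `E`. -/
def IsDiffeoOnto {m : ℕ} (s : ℕ∞)
    (φ : EuclideanSpace ℝ (Fin m) → EuclideanSpace ℝ (Fin m))
    (E : Set (EuclideanSpace ℝ (Fin m))) : Prop :=
  ContDiff ℝ s φ ∧ (∀ z, φ z ∈ E) ∧
  ∃ ψ : EuclideanSpace ℝ (Fin m) → EuclideanSpace ℝ (Fin m),
    ContDiffOn ℝ s ψ E ∧ (∀ z, ψ (φ z) = z) ∧ ∀ y ∈ E, φ (ψ y) = y

/-! Transversality lets trajectories cross `∂E` only inwards, so `E_ε` is the image of `E` under the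
time-`ε` flow and is forward invariant. Slow the field down to `g • χ`, with `g` smooth, equal to
`1` on `E_ε`, positive on `E` and zero exactly off `E`. Its flow `G` has the same orbits inside `E`,
agrees with `Z` forward in time from `E_ε`, and never leaves `E`, since all points outside are
equilibria.

Every `Z`-trajectory reaches `E_ε` by attractivity. Follow `Z` until it does, then `G` backwards for
the same time `t`: `φ z = G (-t) (Z t z)`. The result does not depend on `t`, is the identity on
`E_ε`, and stays in `E`. Exchanging the two flows gives the inverse, because every `G`-trajectory in
`E` also reaches `E_ε`. As `E_ε` is open, one `t` serves a whole neighbourhood, so only `C^s`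
regularity of the time-`t` maps is needed; it comes from the variational equation.

Finally `∂E_ε = Z(∂E, ε)`, and points move by at most `ε sup |χ|`. -/

/-! ### Linear equations, uniqueness and completeness -/

section ODE

open Set Filter Topology

variable {V : Type*} [NormedAddCommGroup V] [NormedSpace ℝ V]

/-- The iterated integrals of the Dyson series of the linear equation `y' = A(t) y`. -/
noncomputable def dysonTerm (A : ℝ → V →L[ℝ] V) (y₀ : V) : ℕ → ℝ → V
  | 0, _ => y₀
  | n + 1, t => ∫ s in (0 : ℝ)..t, A s (dysonTerm A y₀ n s)

theorem continuous_dysonTerm [CompleteSpace V] {A : ℝ → V →L[ℝ] V} (hA : Continuous A) (y₀ : V)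
    (n : ℕ) : Continuous (dysonTerm A y₀ n) := by
  induction n with
  | zero => exact continuous_const
  | succ n ih =>
    exact intervalIntegral.continuous_primitive (μ := MeasureTheory.volume)
      (fun a b => (hA.clm_apply ih).intervalIntegrable a b) 0

theorem hasDerivAt_dysonTerm_succ [CompleteSpace V] {A : ℝ → V →L[ℝ] V} (hA : Continuous A)
    (y₀ : V) (n : ℕ) (t : ℝ) :
    HasDerivAt (dysonTerm A y₀ (n + 1)) (A t (dysonTerm A y₀ n t)) t :=
  (hA.clm_apply (continuous_dysonTerm hA y₀ n)).integral_hasStrictDerivAt 0 t |>.hasDerivAt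

/-- Each integration contributes one factor `M` and raises the power of `|t|`, which produces the `1
/ n!`. The series is thus dominated by an exponential one and can be differentiated term by term. -/
theorem norm_dysonTerm_le {A : ℝ → V →L[ℝ] V} {M T : ℝ} (hM : ∀ t, |t| ≤ T → ‖A t‖ ≤ M) (y₀ : V)
    (n : ℕ) (t : ℝ) (ht : |t| ≤ T) :
    ‖dysonTerm A y₀ n t‖ ≤ ‖y₀‖ * ((M * |t|) ^ n / n.factorial) := by
  have hM0 : 0 ≤ M := (norm_nonneg _).trans (hM t ht)
  induction n generalizing t with
  | zero => simp [dysonTerm]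
  | succ n ih =>
    have h1 : ‖dysonTerm A y₀ (n + 1) t‖ ≤
        |∫ s in (0 : ℝ)..t, M * (‖y₀‖ * (M ^ n / n.factorial)) * |s - 0| ^ n| := by
      refine intervalIntegral.norm_integral_le_abs_of_norm_le ?_ ?_
      · refine MeasureTheory.ae_restrict_of_forall_mem measurableSet_uIoc fun s hs => ?_
        have hs' : |s| ≤ T := by
          have := abs_sub_left_of_mem_uIcc (uIoc_subset_uIcc hs)
          simp only [sub_zero] at this
          exact this.trans ht
        calc ‖A s (dysonTerm A y₀ n s)‖ ≤ ‖A s‖ * ‖dysonTerm A y₀ n s‖ := (A s).le_opNorm _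
          _ ≤ M * (‖y₀‖ * ((M * |s|) ^ n / n.factorial)) := by
            gcongr
            exacts [hM s hs', ih s hs']
          _ = _ := by rw [mul_pow, sub_zero]; ring
      · exact Continuous.intervalIntegrable (by fun_prop) _ _
    refine h1.trans (le_of_eq ?_)
    rw [intervalIntegral.integral_const_mul, abs_mul, intervalIntegral.abs_intervalIntegral_eq,
      integral_pow_abs_sub_uIoc, abs_of_nonneg (by positivity), abs_of_nonneg (by positivity),
      Nat.factorial_succ]
    push_cast
    field_simp
    rw [sub_zero]
    ring

/-- A linear differential equation with continuous coefficients has global solutions. -/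
theorem exists_linear_ode_solution [CompleteSpace V] {A : ℝ → V →L[ℝ] V} (hA : Continuous A)
    (y₀ : V) : ∃ y : ℝ → V, y 0 = y₀ ∧ ∀ t, HasDerivAt y (A t (y t)) t := by
  have hb : ∀ T : ℝ, ∃ M, ∀ t, |t| ≤ T → ‖A t‖ ≤ M := fun T => by
    obtain ⟨M, hM⟩ := (isCompact_Icc (a := -T) (b := T)).exists_bound_of_continuousOn hA.continuousOn
    exact ⟨M, fun t ht => hM t (abs_le.1 ht)⟩
  have hsum : ∀ t, Summable fun n => dysonTerm A y₀ n t := fun t => by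
    obtain ⟨M, hM⟩ := hb |t|
    exact Summable.of_norm_bounded ((Real.summable_pow_div_factorial (M * |t|)).mul_left ‖y₀‖)
      fun n => norm_dysonTerm_le hM y₀ n t le_rfl
  have hzero : ∀ n, dysonTerm A y₀ (n + 1) 0 = 0 := fun n => by simp [dysonTerm]
  refine ⟨fun t => ∑' n, dysonTerm A y₀ n t, ?_, fun t => ?_⟩
  · simp [(hsum 0).tsum_eq_zero_add, hzero]
    rfl
  · obtain ⟨M, hM⟩ := hb (|t| + 1)
    have hM0 : 0 ≤ M := (norm_nonneg _).trans (hM t (by linarith))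
    have key : HasDerivAt (fun s => ∑' n, dysonTerm A y₀ (n + 1) s)
        (∑' n, A t (dysonTerm A y₀ n t)) t := by
      refine hasDerivAt_tsum_of_isPreconnected
        (u := fun n : ℕ => M * (‖y₀‖ * ((M * (|t| + 1)) ^ n / n.factorial)))
        (t := Ioo (-(|t| + 1)) (|t| + 1))
        (g := fun n => dysonTerm A y₀ (n + 1)) (g' := fun n s => A s (dysonTerm A y₀ n s))
        (((Real.summable_pow_div_factorial _).mul_left _).mul_left _)
        isOpen_Ioo isPreconnected_Ioo
        (fun n s _ => hasDerivAt_dysonTerm_succ hA y₀ n s) (fun n s hs => ?_)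
        (y₀ := 0) ⟨by linarith [abs_nonneg t], by linarith [abs_nonneg t]⟩ ?_
        (abs_lt.1 (by linarith))
      · have hs' : |s| ≤ |t| + 1 := (abs_lt.2 hs).le
        refine ((A s).le_opNorm _).trans ?_
        gcongr
        · exact hM s hs'
        · refine (norm_dysonTerm_le hM y₀ n s hs').trans ?_
          gcongr
      · simp [hzero]
    rw [(A t).map_tsum (hsum t)]
    have := key.const_add y₀
    refine this.congr_of_eventuallyEq (Eventually.of_forall fun s => ?_)
    exact (hsum s).tsum_eq_zero_add

theorem IsIntegralCurve.comp_neg {f : V → V} {γ : ℝ → V} (hγ : IsIntegralCurve γ fun _ => f) :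
    IsIntegralCurve (fun t => γ (-t)) fun _ x => -f x := fun t => by
  simpa [Function.comp_def] using (hγ (-t)).scomp t (hasDerivAt_neg t)

variable [FiniteDimensional ℝ V]

theorem ContDiff.exists_lipschitzOnWith_closedBall {W : Type*} [NormedAddCommGroup W]
    [NormedSpace ℝ W] {f : V → W} (hf : ContDiff ℝ 1 f) (x : V) (R : ℝ) :
    ∃ K, LipschitzOnWith K f (Metric.closedBall x R) := by
  have := FiniteDimensional.proper ℝ V
  exact hf.contDiffOn.exists_lipschitzOnWith one_ne_zero (convex_closedBall x R)
    (isCompact_closedBall x R)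

/-- Forward uniqueness for the integral curves of a `C¹` vector field. -/
theorem eqOn_Icc_of_hasDerivWithinAt {f : V → V} (hf : ContDiff ℝ 1 f) {γ δ : ℝ → V} {T : ℝ}
    (hγc : Continuous γ) (hδc : Continuous δ)
    (hγ : ∀ t ∈ Ico 0 T, HasDerivWithinAt γ (f (γ t)) (Ici t) t)
    (hδ : ∀ t ∈ Ico 0 T, HasDerivWithinAt δ (f (δ t)) (Ici t) t) (h0 : γ 0 = δ 0) :
    EqOn γ δ (Icc 0 T) := by
  obtain ⟨R₁, h₁⟩ := (isCompact_Icc (a := 0) (b := T)).exists_bound_of_continuousOn hγc.continuousOn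
  obtain ⟨R₂, h₂⟩ := (isCompact_Icc (a := 0) (b := T)).exists_bound_of_continuousOn hδc.continuousOn
  obtain ⟨K, hK⟩ := hf.exists_lipschitzOnWith_closedBall 0 (max R₁ R₂)
  refine ODE_solution_unique_of_mem_Icc_right (v := fun _ => f) (fun _ _ => hK) hγc.continuousOn hγ
    (fun t ht => ?_) hδc.continuousOn hδ (fun t ht => ?_) h0
  · simpa using Or.inl (h₁ t (Ico_subset_Icc_self ht))
  · simpa using Or.inr (h₂ t (Ico_subset_Icc_self ht))

/-- Global integral curves of a `C¹` vector field are determined by their initial value. -/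
theorem IsIntegralCurve.eq_of_contDiff {f : V → V} (hf : ContDiff ℝ 1 f) {γ δ : ℝ → V}
    (hγ : IsIntegralCurve γ fun _ => f) (hδ : IsIntegralCurve δ fun _ => f) (h0 : γ 0 = δ 0) :
    γ = δ := by
  ext t
  rcases le_total 0 t with ht | ht
  · exact eqOn_Icc_of_hasDerivWithinAt hf hγ.continuous hδ.continuous
      (fun s _ => (hγ s).hasDerivWithinAt) (fun s _ => (hδ s).hasDerivWithinAt) h0 ⟨ht, le_rfl⟩
  · have := eqOn_Icc_of_hasDerivWithinAt (T := -t) hf.neg hγ.comp_neg.continuous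
      hδ.comp_neg.continuous (fun s _ => (hγ.comp_neg s).hasDerivWithinAt)
      (fun s _ => (hδ.comp_neg s).hasDerivWithinAt) (by simpa using h0)
      ⟨neg_nonneg.2 ht, le_rfl⟩
    simpa using this

/-- A bounded `C¹` vector field is complete. -/
theorem exists_isIntegralCurve_of_bounded {f : V → V} (hf : ContDiff ℝ 1 f)
    (hb : ∃ C, ∀ x, ‖f x‖ ≤ C) (x : V) :
    ∃ γ : ℝ → V, γ 0 = x ∧ IsIntegralCurve γ fun _ => f := by
  obtain ⟨C, hC⟩ := hb
  lift C to NNReal using (norm_nonneg _).trans (hC x)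
  -- At speed at most `C` a solution stays in the ball of radius `C * T` up to time `T`, so
  -- Picard–Lindelöf applies on the whole interval.
  have hloc : ∀ T : NNReal, ∃ γ : ℝ → V, γ 0 = x ∧ ContinuousOn γ (Icc (-T : ℝ) T) ∧
      ∀ t ∈ Ioo (-T : ℝ) T, HasDerivAt γ (f (γ t)) t := fun T => by
    obtain ⟨K, hK⟩ := hf.exists_lipschitzOnWith_closedBall x (C * T : NNReal)
    have hp : IsPicardLindelof (fun _ => f) (tmin := -T) (tmax := T) ⟨0, by simp⟩ x (C * T) 0 C K :=
      .of_time_independent (fun y _ => hC y) hK (by simp)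
    obtain ⟨γ, h0, h⟩ := hp.exists_eq_forall_mem_Icc_hasDerivWithinAt₀
    exact ⟨γ, h0, fun t ht => (h t ht).continuousWithinAt,
      fun t ht => (h t (Ioo_subset_Icc_self ht)).hasDerivAt (Icc_mem_nhds ht.1 ht.2)⟩
  choose γ h0 hc h using hloc
  have hagree : ∀ S T : NNReal, 0 < S → S ≤ T → EqOn (γ S) (γ T) (Icc (-S : ℝ) S) :=
      fun S T hS hST => by
    have hS' : (0 : ℝ) < S := hS
    have hST' : (S : ℝ) ≤ T := hST
    have hsub : Icc (-S : ℝ) S ⊆ Icc (-T : ℝ) T := Icc_subset_Icc (neg_le_neg hST') hST'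
    obtain ⟨R₁, h₁⟩ := (isCompact_Icc (a := (-S : ℝ)) (b := (S : ℝ))).exists_bound_of_continuousOn
      (hc S)
    obtain ⟨R₂, h₂⟩ := (isCompact_Icc (a := (-S : ℝ)) (b := (S : ℝ))).exists_bound_of_continuousOn
      ((hc T).mono hsub)
    obtain ⟨K, hK⟩ := hf.exists_lipschitzOnWith_closedBall 0 (max R₁ R₂)
    refine ODE_solution_unique_of_mem_Icc (v := fun _ => f) (t₀ := 0) (fun _ _ => hK)
      ⟨neg_lt_zero.2 hS', hS'⟩ (hc S) (h S) (fun t ht => ?_) ((hc T).mono hsub)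
      (fun t ht => h T t (Ioo_subset_Ioo (neg_le_neg hST') hST' ht)) (fun t ht => ?_)
      ((h0 S).trans (h0 T).symm)
    · simpa using Or.inl (h₁ t (Ioo_subset_Icc_self ht))
    · simpa using Or.inr (h₂ t (Ioo_subset_Icc_self ht))
  -- The `+ 1` keeps `t` inside the interval of its local solution; for `s` within `1` of `t`, all
  -- these solutions agree with the one for `‖t‖₊ + 2`.
  refine ⟨fun t => γ (‖t‖₊ + 1) t, h0 _, fun t => ?_⟩
  have ht : t ∈ Ioo (-((‖t‖₊ + 2 : NNReal) : ℝ)) (‖t‖₊ + 2 : NNReal) := by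
    simp only [NNReal.coe_add, coe_nnnorm, Real.norm_eq_abs, NNReal.coe_ofNat]
    exact abs_lt.1 (by linarith)
  have heq : (fun s => γ (‖s‖₊ + 1) s) =ᶠ[𝓝 t] γ (‖t‖₊ + 2) := by
    filter_upwards [Metric.ball_mem_nhds t one_pos] with s hs
    have hs' : ‖s‖ ≤ ‖t‖ + 1 := by
      have := norm_le_norm_add_norm_sub' s t
      rw [Metric.mem_ball, dist_eq_norm] at hs
      linarith
    refine hagree _ _ (by positivity) ?_ ?_
    · rw [← NNReal.coe_le_coe]
      simp only [NNReal.coe_add, coe_nnnorm, NNReal.coe_ofNat, NNReal.coe_one]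
      linarith
    · simp only [NNReal.coe_add, coe_nnnorm, Real.norm_eq_abs, NNReal.coe_one]
      exact abs_le.1 (by linarith)
  have := (h _ t ht).congr_of_eventuallyEq heq
  rwa [← heq.eq_of_nhds] at this

end ODE

/-! ### Smooth dependence on initial values -/

section SmoothDependence

open Set Filter Topology

/-- `Φ` is a global flow of the vector field `f` which is bounded on bounded sets,
uniformly in bounded intervals of positive times. -/
structure IsGlobalFlow {V : Type*} [NormedAddCommGroup V] [NormedSpace ℝ V] (f : V → V)
    (Φ : ℝ → V → V) : Prop where
  zero : ∀ x, Φ 0 x = x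
  curve : ∀ x, IsIntegralCurve (fun t => Φ t x) fun _ => f
  bounded : ∀ T R : ℝ, ∃ R', ∀ t ∈ Icc 0 T, ∀ x, ‖x‖ ≤ R → ‖Φ t x‖ ≤ R'

/-- Strict differentiability makes `g - g' x` Lipschitz with a small constant near `x`, which bounds
its derivative `g' y - g' x`. Continuity of the derivative of the flow thus needs no separate
estimate. -/
theorem continuous_of_hasStrictFDerivAt {V W : Type*} [NormedAddCommGroup V] [NormedSpace ℝ V]
    [NormedAddCommGroup W] [NormedSpace ℝ W] {g : V → W} {g' : V → V →L[ℝ] W}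
    (h : ∀ x, HasStrictFDerivAt g (g' x) x) : Continuous g' := by
  refine continuous_iff_continuousAt.2 fun x => Metric.continuousAt_iff'.2 fun ε hε => ?_
  have h1 := (h x).isLittleO.def (half_pos hε)
  rw [nhds_prod_eq] at h1
  obtain ⟨s, hs, hsub⟩ := Filter.mem_prod_same_iff.1 h1
  filter_upwards [eventually_mem_nhds_iff.2 hs] with y hy
  rw [dist_eq_norm]
  have hd : HasFDerivAt (fun z => g z - g' x z) (g' y - g' x) y :=
    (h y).hasFDerivAt.sub (g' x).hasFDerivAt
  refine (hd.le_of_lipschitzOn (C := ⟨ε / 2, (half_pos hε).le⟩) hy ?_).trans_lt (half_lt_self hε)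
  refine LipschitzOnWith.of_dist_le_mul fun a ha b hb => ?_
  have := hsub (mk_mem_prod ha hb)
  simp only [mem_ofPred_eq, map_sub] at this
  rw [dist_eq_norm, dist_eq_norm, show g a - g' x a - (g b - g' x b) =
    g a - g b - (g' x a - g' x b) by abel]
  exact this

universe u

variable {V : Type u} [NormedAddCommGroup V] [NormedSpace ℝ V] [FiniteDimensional ℝ V]
  {f : V → V} {Φ : ℝ → V → V}

/-- The first variational equation has a global solution along every trajectory. -/
theorem exists_variational_solution (hf : ContDiff ℝ 1 f) (h : IsGlobalFlow f Φ) (x : V) :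
    ∃ Y : ℝ → V →L[ℝ] V, Y 0 = ContinuousLinearMap.id ℝ V ∧
      ∀ t, HasDerivAt Y ((fderiv ℝ f (Φ t x)).comp (Y t)) t := by
  have := FiniteDimensional.complete ℝ V
  exact exists_linear_ode_solution
    (A := fun t => ContinuousLinearMap.compL ℝ V V V (fderiv ℝ f (Φ t x)))
    ((ContinuousLinearMap.compL ℝ V V V).continuous.comp
      ((hf.continuous_fderiv one_ne_zero).comp (h.curve x).continuous)) _

theorem exists_norm_fderiv_le (hf : ContDiff ℝ 1 f) (R : ℝ) :
    ∃ M, 0 < M ∧ ∀ x, ‖x‖ ≤ R → ‖fderiv ℝ f x‖ ≤ M := by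
  have := FiniteDimensional.proper ℝ V
  obtain ⟨M, hM⟩ := (isCompact_closedBall (0 : V) R).exists_bound_of_continuousOn
    (hf.continuous_fderiv one_ne_zero).continuousOn
  exact ⟨max M 1, by positivity, fun x hx => (hM x (by simpa using hx)).trans (le_max_left _ _)⟩

/-- The solution of the first variational equation is the derivative of the flow. -/
theorem hasStrictFDerivAt_flow (hf : ContDiff ℝ 1 f) (h : IsGlobalFlow f Φ) {x : V}
    {Y : ℝ → V →L[ℝ] V} (hY0 : Y 0 = ContinuousLinearMap.id ℝ V)
    (hY : ∀ t, HasDerivAt Y ((fderiv ℝ f (Φ t x)).comp (Y t)) t) {T : ℝ} (hT : 0 ≤ T) :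
    HasStrictFDerivAt (Φ T) (Y T) x := by
  have := FiniteDimensional.proper ℝ V
  obtain ⟨R, hR⟩ := h.bounded T (‖x‖ + 1)
  obtain ⟨K, hK⟩ := hf.exists_lipschitzOnWith_closedBall 0 R
  obtain ⟨M, hM0, hM⟩ := exists_norm_fderiv_le hf R
  have hlip : ∀ y z, ‖y‖ ≤ ‖x‖ + 1 → ‖z‖ ≤ ‖x‖ + 1 → ∀ t ∈ Icc 0 T,
      dist (Φ t y) (Φ t z) ≤ dist y z * Real.exp (K * T) := fun y z hy hz t ht => by
    have := dist_le_of_trajectories_ODE_of_mem (v := fun _ => f) (fun _ _ => hK)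
      (h.curve y).continuous.continuousOn (fun t _ => (h.curve y t).hasDerivWithinAt)
      (fun t ht => by simpa using hR t (Ico_subset_Icc_self ht) y hy)
      (h.curve z).continuous.continuousOn (fun t _ => (h.curve z t).hasDerivWithinAt)
      (fun t ht => by simpa using hR t (Ico_subset_Icc_self ht) z hz) le_rfl t ht
    simp only [h.zero, sub_zero] at this
    refine this.trans ?_
    gcongr
    exact ht.2
  refine .of_isLittleO (Asymptotics.isLittleO_iff.2 fun c hc => ?_)
  set C₀ := Real.exp (K * T)
  have hC₀ : 0 < C₀ := Real.exp_pos _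
  -- Chosen so that the Grönwall bound `η * (‖y - z‖ * C₀) / M * exp (M * T)` equals `c * ‖y - z‖`.
  set η := c * M / (C₀ * Real.exp (M * T)) with hη
  have hη0 : 0 < η := by positivity
  obtain ⟨δ, hδ0, hδ⟩ := Metric.uniformContinuousOn_iff_le.1
    ((isCompact_closedBall (0 : V) (R + 1)).uniformContinuousOn_of_continuous
      (hf.continuous_fderiv one_ne_zero).continuousOn) η hη0
  set ρ := min 1 (min 1 δ / C₀) with hρ
  have hρ0 : 0 < ρ := by positivity
  have hnear : ∀ y ∈ Metric.ball x ρ, ‖y‖ ≤ ‖x‖ + 1 ∧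
      ∀ t ∈ Icc 0 T, Φ t y ∈ Metric.closedBall (Φ t x) (min 1 δ) := fun y hy => by
    have hy1 : ‖y‖ ≤ ‖x‖ + 1 := by
      have := norm_le_norm_add_norm_sub' y x
      rw [Metric.mem_ball, dist_eq_norm] at hy
      linarith [hy.trans_le (min_le_left _ _)]
    refine ⟨hy1, fun t ht => (hlip y x hy1 (by linarith) t ht).trans ?_⟩
    rw [← le_div_iff₀ hC₀]
    exact (Metric.mem_ball.1 hy).le.trans (min_le_right _ _)
  rw [nhds_prod_eq]
  filter_upwards [prod_mem_prod (Metric.ball_mem_nhds x hρ0) (Metric.ball_mem_nhds x hρ0)]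
  rintro ⟨y, z⟩ ⟨hy, hz⟩
  obtain ⟨hy1, hyt⟩ := hnear y hy
  obtain ⟨hz1, hzt⟩ := hnear z hz
  have hmean : ∀ t ∈ Icc 0 T, ‖f (Φ t y) - f (Φ t z) - fderiv ℝ f (Φ t x) (Φ t y - Φ t z)‖ ≤
      η * (dist y z * C₀) := fun t ht => by
    have hx' : ‖Φ t x‖ ≤ R := hR t ht x (by linarith)
    refine (Convex.norm_image_sub_le_of_norm_fderiv_le' (𝕜 := ℝ) (C := η)
      (s := Metric.closedBall (Φ t x) (min 1 δ)) (fun p _ => hf.differentiable one_ne_zero p)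
      (fun p hp => ?_) (convex_closedBall _ _) (hzt t ht) (hyt t ht)).trans ?_
    · rw [← dist_eq_norm]
      refine hδ p ?_ _ ?_ ((Metric.mem_closedBall.1 hp).trans (min_le_right _ _))
      · have h1 := (Metric.mem_closedBall.1 hp).trans (min_le_left _ _)
        rw [dist_eq_norm] at h1
        have := norm_le_norm_add_norm_sub' p (Φ t x)
        simp only [mem_closedBall_zero_iff]
        linarith
      · simp only [mem_closedBall_zero_iff]
        linarith
    · rw [← dist_eq_norm]
      gcongr
      exact hlip y z hy1 hz1 t ht
  -- The linearization error vanishes at time `0` and solves the variational equation up to the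
  -- forcing term bounded in `hmean`.
  have hG := norm_le_gronwallBound_of_norm_deriv_right_le
    (f := fun t => Φ t y - Φ t z - Y t (y - z)) (a := 0) (b := T) (δ := 0) (K := M)
    (ε := η * (dist y z * C₀))
    (f' := fun t => f (Φ t y) - f (Φ t z) - (fderiv ℝ f (Φ t x)).comp (Y t) (y - z))
    (HasDerivAt.continuousOn fun t _ => ((h.curve y t).fun_sub (h.curve z t)).fun_sub
      ((hY t).clm_apply (hasDerivAt_const t (y - z))))
    (fun t _ => by
      simpa using (((h.curve y t).fun_sub (h.curve z t)).fun_sub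
        ((hY t).clm_apply (hasDerivAt_const t (y - z)))).hasDerivWithinAt)
    (by simp [h.zero, hY0]) (fun t ht => ?_) T ⟨hT, le_rfl⟩
  · refine hG.trans ?_
    rw [gronwallBound_of_K_ne_0 hM0.ne', dist_eq_norm]
    have h1 : η * (‖y - z‖ * C₀) / M * (Real.exp (M * (T - 0)) - 1) ≤
        η * (‖y - z‖ * C₀) / M * Real.exp (M * T) := by
      rw [sub_zero]
      gcongr
      linarith
    refine (by simpa using h1 : _ ≤ _).trans (le_of_eq ?_)
    rw [hη]
    field_simp
  · have ht' := Ico_subset_Icc_self ht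
    have : f (Φ t y) - f (Φ t z) - (fderiv ℝ f (Φ t x)).comp (Y t) (y - z) =
        fderiv ℝ f (Φ t x) (Φ t y - Φ t z - Y t (y - z)) +
        (f (Φ t y) - f (Φ t z) - fderiv ℝ f (Φ t x) (Φ t y - Φ t z)) := by
      simp only [map_sub, ContinuousLinearMap.comp_apply]
      abel
    rw [this]
    refine (norm_add_le _ _).trans (add_le_add ?_ (hmean t ht'))
    refine (ContinuousLinearMap.le_opNorm _ _).trans ?_
    gcongr
    exact hM _ (hR t ht' x (by linarith))

/-- The flow of a vector field, linearized along its trajectories, is a flow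
of the tangent vector field. -/
theorem IsGlobalFlow.tangent (hf : ContDiff ℝ 1 f) (h : IsGlobalFlow f Φ)
    {Y : V → ℝ → V →L[ℝ] V} (hY0 : ∀ x, Y x 0 = ContinuousLinearMap.id ℝ V)
    (hY : ∀ x t, HasDerivAt (Y x) ((fderiv ℝ f (Φ t x)).comp (Y x t)) t) :
    IsGlobalFlow (fun p : V × V => (f p.1, fderiv ℝ f p.1 p.2))
      (fun t p => (Φ t p.1, Y p.1 t p.2)) where
  zero p := by simp [h.zero, hY0]
  curve p t := by
    have h2 := (hY p.1 t).clm_apply (hasDerivAt_const t p.2)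
    simp only [map_zero, add_zero] at h2
    exact (h.curve p.1 t).prodMk h2
  bounded T R := by
    obtain ⟨R', hR'⟩ := h.bounded T R
    obtain ⟨M, hM0, hM⟩ := exists_norm_fderiv_le hf R'
    refine ⟨max R' (Real.exp (M * T) * R), fun t ht p hp => ?_⟩
    have hp1 : ‖p.1‖ ≤ R := (norm_fst_le p).trans hp
    have hp2 : ‖p.2‖ ≤ R := (norm_snd_le p).trans hp
    rw [Prod.norm_def]
    refine max_le_max (hR' t ht _ hp1) ?_
    have hG := norm_le_gronwallBound_of_norm_deriv_right_le (f := Y p.1) (a := 0) (b := T)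
      (δ := 1) (K := M) (ε := 0) (HasDerivAt.continuousOn fun t _ => hY p.1 t)
      (fun t _ => (hY p.1 t).hasDerivWithinAt)
      (by rw [hY0]; exact ContinuousLinearMap.norm_id_le) (fun t ht => ?_) t ht
    · rw [gronwallBound_ε0, one_mul, sub_zero] at hG
      refine (ContinuousLinearMap.le_opNorm _ _).trans ?_
      gcongr
      exact hG.trans (by gcongr; exact ht.2)
    · rw [add_zero]
      refine (ContinuousLinearMap.opNorm_comp_le _ _).trans ?_
      gcongr
      exact hM _ (hR' t (Ico_subset_Icc_self ht) _ hp1)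

/-- The derivative of `Φ t` at `x` applied to `v` is the second component of the tangent flow at
`(x, v)`. The tangent field is one degree less smooth but lives on `V × V`, so the induction must
range over all spaces. -/
theorem contDiff_flow_nat (n : ℕ) : ∀ {V : Type u} [NormedAddCommGroup V] [NormedSpace ℝ V]
    [FiniteDimensional ℝ V] {f : V → V} {Φ : ℝ → V → V}, ContDiff ℝ (n + 1) f →
    IsGlobalFlow f Φ → ∀ {t : ℝ}, 0 ≤ t → ContDiff ℝ (n + 1) (Φ t) := by
  induction n with
  | zero =>
    intro V _ _ _ f Φ hf h t ht
    rw [Nat.cast_zero, zero_add] at hf ⊢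
    choose Y hY0 hY using exists_variational_solution hf h
    have hd := fun x => hasStrictFDerivAt_flow hf h (hY0 x) (hY x) ht
    rw [contDiff_one_iff_fderiv]
    refine ⟨fun x => (hd x).differentiableAt, ?_⟩
    convert continuous_of_hasStrictFDerivAt hd using 1
    exact funext fun x => (hd x).hasFDerivAt.fderiv
  | succ n ih =>
    intro V _ _ _ f Φ hf h t ht
    have hf1 : ContDiff ℝ 1 f := hf.of_le (by simp)
    choose Y hY0 hY using exists_variational_solution hf1 h
    have hd := fun x => hasStrictFDerivAt_flow hf1 h (hY0 x) (hY x) ht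
    rw [contDiff_succ_iff_fderiv_apply]
    refine ⟨fun x => (hd x).differentiableAt, by simp, fun v => ?_⟩
    have hF : ContDiff ℝ (n + 1) fun p : V × V => (f p.1, fderiv ℝ f p.1 p.2) := by
      have hf' : ContDiff ℝ (n + 1) (fderiv ℝ f) := hf.fderiv_right (by push_cast; rfl)
      exact ((hf.of_le (by simp)).comp contDiff_fst).prodMk
        ((hf'.comp contDiff_fst).clm_apply contDiff_snd)
    have := (ih hF (h.tangent hf1 hY0 hY) ht).snd.comp
      (contDiff_id.prodMk (contDiff_const (c := v)))
    push_cast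
    convert this using 1
    exact funext fun x => by simp [(hd x).hasFDerivAt.fderiv]

/-- The time-`t` map of the flow of a `C^s` vector field is `C^s`. -/
theorem IsGlobalFlow.contDiff {s : ℕ∞} (hs : 1 ≤ s) (hf : ContDiff ℝ s f) (h : IsGlobalFlow f Φ)
    {t : ℝ} (ht : 0 ≤ t) : ContDiff ℝ s (Φ t) := by
  refine contDiff_iff_forall_nat_le.2 fun m hm => ?_
  rcases m with _ | m
  · exact (contDiff_flow_nat 0 (hf.of_le (by simpa using hs)) h ht).of_le (by simp)
  · exact_mod_cast contDiff_flow_nat m (hf.of_le (by exact_mod_cast hm)) h ht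

end SmoothDependence

/-! ### Complete flows, their conjugation and reparametrization -/

section CompleteFlows

open Set Filter Topology

variable {V : Type*} [NormedAddCommGroup V] [NormedSpace ℝ V]

/-- `Φ` is the flow of the complete vector field `f`. -/
structure IsFlowOf (f : V → V) (Φ : ℝ → V → V) : Prop where
  zero : ∀ x, Φ 0 x = x
  curve : ∀ x, IsIntegralCurve (fun t => Φ t x) fun _ => f
  add : ∀ s t x, Φ (s + t) x = Φ s (Φ t x)

theorem IsFlowOf.neg_apply {f : V → V} {Φ : ℝ → V → V} (h : IsFlowOf f Φ) (t : ℝ) (x : V) :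
    Φ (-t) (Φ t x) = x := by
  rw [← h.add, neg_add_cancel, h.zero]

theorem IsFlowOf.apply_neg {f : V → V} {Φ : ℝ → V → V} (h : IsFlowOf f Φ) (t : ℝ) (x : V) :
    Φ t (Φ (-t) x) = x := by
  rw [← h.add, add_neg_cancel, h.zero]

theorem IsFlowOf.norm_sub_le {f : V → V} {Φ : ℝ → V → V} (h : IsFlowOf f Φ) {C : ℝ}
    (hC : ∀ x, ‖f x‖ ≤ C) (t : ℝ) (x : V) : ‖Φ t x - x‖ ≤ C * |t| := by
  have := convex_univ.norm_image_sub_le_of_norm_hasDerivWithin_le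
    (fun s _ => (h.curve x s).hasDerivWithinAt) (fun s _ => hC (Φ s x)) (mem_univ 0) (mem_univ t)
  simpa [h.zero] using this

theorem exists_flow_of_bounded [FiniteDimensional ℝ V] {s : ℕ∞} (hs : 1 ≤ s) {f : V → V}
    (hf : ContDiff ℝ s f) {C : ℝ} (hC : ∀ x, ‖f x‖ ≤ C) :
    ∃ Φ : ℝ → V → V, IsFlowOf f Φ ∧ ∀ t, ContDiff ℝ s (Φ t) := by
  have hf1 : ContDiff ℝ 1 f := hf.of_le (by exact_mod_cast hs)
  choose γ h0 hγ using exists_isIntegralCurve_of_bounded hf1 ⟨C, hC⟩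
  have hflow : IsFlowOf f fun t x => γ x t := by
    refine ⟨h0, hγ, fun s t x => ?_⟩
    exact congrFun (IsIntegralCurve.eq_of_contDiff hf1 ((hγ x).comp_add t) (hγ (γ x t))
      (by simp [h0])) s
  have hbdd : ∀ T R : ℝ, ∃ R', ∀ t, |t| ≤ T → ∀ x, ‖x‖ ≤ R → ‖γ x t‖ ≤ R' := fun T R => by
    refine ⟨R + C * T, fun t ht x hx => ?_⟩
    have hC0 : 0 ≤ C := (norm_nonneg _).trans (hC x)
    have h1 := hflow.norm_sub_le hC t x
    have h2 := norm_le_norm_add_norm_sub' (γ x t) x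
    have h3 : C * |t| ≤ C * T := by gcongr
    linarith
  have hpos : IsGlobalFlow f fun t x => γ x t := by
    refine ⟨h0, hγ, fun T R => ?_⟩
    obtain ⟨R', hR'⟩ := hbdd T R
    exact ⟨R', fun t ht => hR' t (by rw [abs_of_nonneg ht.1]; exact ht.2)⟩
  have hneg : IsGlobalFlow (fun x => -f x) fun t x => γ x (-t) := by
    refine ⟨fun x => by simp [h0], fun x => (hγ x).comp_neg, fun T R => ?_⟩
    obtain ⟨R', hR'⟩ := hbdd T R
    exact ⟨R', fun t ht => hR' (-t) (by rw [abs_neg, abs_of_nonneg ht.1]; exact ht.2)⟩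
  refine ⟨fun t x => γ x t, hflow, fun t => ?_⟩
  rcases le_total 0 t with ht | ht
  · exact hpos.contDiff hs hf ht
  · simpa using hneg.contDiff hs hf.neg (neg_nonneg.2 ht)

open Classical in
/-- The conjugation from the flow `P` to the flow `Q`: follow `P` into `A`, where the two flows
agree, and go back for the same time along `Q`. -/
noncomputable def flowConj (P Q : ℝ → V → V) (A : Set V) (z : V) : V :=
  if h : ∃ t, 0 ≤ t ∧ P t z ∈ A then Q (-h.choose) (P h.choose z) else z

section Conjugation

variable {p q : V → V} {P Q : ℝ → V → V} {A : Set V} (hP : IsFlowOf p P) (hQ : IsFlowOf q Q)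
  (hA : ∀ z ∈ A, ∀ t, 0 ≤ t → P t z ∈ A ∧ P t z = Q t z)

include hP hQ hA

/-- Once `P` has entered `A`, waiting longer moves forward along `P` and back along `Q` by the same
amount, and the two cancel. -/
theorem flowConj_eq {z : V} {t : ℝ} (ht : 0 ≤ t) (hz : P t z ∈ A) :
    flowConj P Q A z = Q (-t) (P t z) := by
  have key : ∀ s t, 0 ≤ s → s ≤ t → P s z ∈ A → Q (-t) (P t z) = Q (-s) (P s z) := by
    intro s t _ hst hs
    have h1 : P t z = Q (t - s) (P s z) := by
      rw [← (hA _ hs _ (sub_nonneg.2 hst)).2, ← hP.add, sub_add_cancel]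
    rw [h1, ← hQ.add]
    congr 1
    ring
  have hex : ∃ t, 0 ≤ t ∧ P t z ∈ A := ⟨t, ht, hz⟩
  rw [flowConj, dif_pos hex]
  obtain ⟨h0, h1⟩ := hex.choose_spec
  rcases le_total hex.choose t with h | h
  · exact (key _ _ h0 h h1).symm
  · exact key _ _ ht h hz

theorem flowConj_eq_self {z : V} (hz : z ∈ A) : flowConj P Q A z = z := by
  rw [flowConj_eq hP hQ hA le_rfl (by rwa [hP.zero]), neg_zero, hP.zero, hQ.zero]

theorem apply_flowConj {z : V} {t : ℝ} (ht : 0 ≤ t) (hz : P t z ∈ A) :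
    Q t (flowConj P Q A z) = P t z := by
  rw [flowConj_eq hP hQ hA ht hz, hQ.apply_neg]

/-- The `Q`-trajectory of the image is at `P t z ∈ A` at the same time `t`, so this `t` also
computes the conjugation with the flows exchanged. -/
theorem flowConj_flowConj {z : V} {t : ℝ} (ht : 0 ≤ t) (hz : P t z ∈ A) :
    flowConj Q P A (flowConj P Q A z) = z := by
  have h := apply_flowConj hP hQ hA ht hz
  rw [flowConj_eq hQ hP (fun z hz t ht => ?_) ht (by rwa [h]), h, hP.neg_apply]
  obtain ⟨h1, h2⟩ := hA z hz t ht
  exact ⟨h2 ▸ h1, h2.symm⟩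

theorem contDiffAt_flowConj {s : ℕ∞} (hPs : ∀ t, ContDiff ℝ s (P t))
    (hQs : ∀ t, ContDiff ℝ s (Q t)) (hAo : IsOpen A) {z : V} {t : ℝ} (ht : 0 ≤ t)
    (hz : P t z ∈ A) : ContDiffAt ℝ s (flowConj P Q A) z := by
  refine ((hQs (-t)).comp (hPs t)).contDiffAt.congr_of_eventuallyEq ?_
  filter_upwards [(hAo.preimage (hPs t).continuous).mem_nhds hz] with y hy
  exact flowConj_eq hP hQ hA ht hy

end Conjugation

/-- Multiplying a vector field by a scalar function reparametrizes its trajectories. -/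
theorem exists_reparametrization [FiniteDimensional ℝ V] {f : V → V} (hf : ContDiff ℝ 1 f)
    {g : V → ℝ} (hg : ContDiff ℝ 1 g) (hg1 : ∃ C, ∀ x, ‖g x‖ ≤ C) {Φ Ψ : ℝ → V → V}
    (hΦ : IsFlowOf f Φ) (hΨ : IsFlowOf (fun x => g x • f x) Ψ) (y : V) :
    ∃ θ : ℝ → ℝ, θ 0 = 0 ∧ (∀ t, HasDerivAt θ (g (Φ (θ t) y)) t) ∧
      ∀ t, Ψ t y = Φ (θ t) y := by
  have hc : ContDiff ℝ 1 fun τ => Φ τ y := by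
    rw [contDiff_one_iff_deriv]
    refine ⟨fun τ => (hΦ.curve y τ).differentiableAt, ?_⟩
    have : deriv (fun τ => Φ τ y) = fun τ => f (Φ τ y) := funext fun τ => (hΦ.curve y τ).deriv
    rw [this]
    exact hf.continuous.comp (hΦ.curve y).continuous
  obtain ⟨C, hC⟩ := hg1
  obtain ⟨θ, h0, hθ⟩ := exists_isIntegralCurve_of_bounded (hg.comp hc)
    ⟨C, fun τ => hC _⟩ 0
  refine ⟨θ, h0, hθ, fun t => ?_⟩
  have hcurve : IsIntegralCurve (fun t => Φ (θ t) y) fun _ x => g x • f x := fun t =>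
    (hΦ.curve y (θ t)).scomp t (hθ t)
  exact congrFun (IsIntegralCurve.eq_of_contDiff (hg.smul hf) (hΨ.curve y) hcurve
    (by simp [hΨ.zero, hΦ.zero, h0])) t

end CompleteFlows

/-! ### Crossing the zero level -/

section Transversality

open Set Filter Topology

/-- A function with negative derivative at its zeros becomes negative as soon as it is
nonpositive. -/
theorem neg_of_nonpos_of_deriv_neg {h h' : ℝ → ℝ} (hd : ∀ t, HasDerivAt h (h' t) t)
    (hz : ∀ t, h t = 0 → h' t < 0) {a b : ℝ} (hab : a < b) (ha : h a ≤ 0) : h b < 0 := by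
  have hle : ∀ x ∈ Icc a b, h x ≤ 0 :=
    image_le_of_deriv_right_lt_deriv_boundary (B := fun _ => 0) (B' := fun _ => 0)
      (HasDerivAt.continuousOn fun t _ => hd t) (fun t _ => (hd t).hasDerivWithinAt) ha
      (fun t => hasDerivAt_const t 0) (fun t _ ht => hz t ht)
  refine (hle b (right_mem_Icc.2 hab.le)).lt_of_ne fun hb => ?_
  have hslope := (hasDerivAt_iff_tendsto_slope.1 (hd b)).mono_left (nhdsLT_le_nhdsNE b)
  -- If `h b = 0` is reached through nonpositive values, the left difference quotients are
  -- nonnegative, against `h' b < 0`.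
  have hpos : ∀ᶠ t in 𝓝[<] b, 0 ≤ slope h b t := by
    filter_upwards [Ioo_mem_nhdsLT hab] with t ht
    rw [slope_def_field, hb, sub_zero]
    exact div_nonneg_of_nonpos (hle t (Ioo_subset_Icc_self ht)) (by linarith [ht.2])
  exact absurd (ge_of_tendsto hslope hpos) (not_le.2 (hz b hb))

variable {V : Type*} [NormedAddCommGroup V] [NormedSpace ℝ V] {χ : V → V} {Z : ℝ → V → V}
  {κ : V → ℝ} (hZ : IsFlowOf χ Z) (hκ : ContDiff ℝ 1 κ)
  (ht : ∀ z, κ z = 0 → fderiv ℝ κ z (χ z) < 0)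

include hZ hκ ht

theorem flow_neg_of_nonpos {z : V} (hz : κ z ≤ 0) {t : ℝ} (h0 : 0 < t) : κ (Z t z) < 0 := by
  refine neg_of_nonpos_of_deriv_neg (h := fun t => κ (Z t z))
    (fun t => (hκ.differentiable one_ne_zero _).hasFDerivAt.comp_hasDerivAt t (hZ.curve z t))
    (fun t h => ht _ h) h0 (by simpa [hZ.zero] using hz)

theorem flow_neg_of_neg {z : V} (hz : κ z < 0) {t : ℝ} (h0 : 0 ≤ t) : κ (Z t z) < 0 := by
  rcases h0.eq_or_lt with rfl | h0
  · rwa [hZ.zero]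
  · exact flow_neg_of_nonpos hZ hκ ht hz.le h0

/-- The flow enters `κ < 0` immediately from any zero of `κ`, so every zero is a limit of points of
the sublevel set. -/
theorem frontier_sublevel : frontier {z | κ z < 0} = {z | κ z = 0} := by
  refine (frontier_lt_subset_eq hκ.continuous continuous_const).antisymm fun z hz => ?_
  have ho : IsOpen {z | κ z < 0} := isOpen_lt hκ.continuous continuous_const
  rw [frontier, ho.interior_eq]
  refine ⟨?_, fun h => h.ne hz⟩
  have hlim : Tendsto (fun t => Z t z) (𝓝[>] 0) (𝓝 z) := by
    have := (hZ.curve z).continuous.tendsto 0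
    simp only [hZ.zero] at this
    exact this.mono_left nhdsWithin_le_nhds
  refine mem_closure_of_tendsto hlim ?_
  filter_upwards [self_mem_nhdsWithin] with t h0
  exact flow_neg_of_nonpos hZ hκ ht (le_of_eq hz) h0

end Transversality

/-! ### Inner set, cutoff and diffeomorphism -/

section ConditionB

open Set Filter Topology Manifold

variable {m : ℕ} {χ : EuclideanSpace ℝ (Fin m) → EuclideanSpace ℝ (Fin m)}
  {Z : ℝ → EuclideanSpace ℝ (Fin m) → EuclideanSpace ℝ (Fin m)}
  {κ : EuclideanSpace ℝ (Fin m) → ℝ}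

theorem flowsTo_iff (hχ : ContDiff ℝ 1 χ) (hZ : IsFlowOf χ Z) {t : ℝ}
    {x y : EuclideanSpace ℝ (Fin m)} : FlowsTo χ t x y ↔ Z t x = y := by
  refine ⟨fun ⟨γ, hγ, h0, h1⟩ => ?_, fun h => ⟨fun t => Z t x, hZ.curve x, hZ.zero x, h⟩⟩
  rw [← h1, IsIntegralCurve.eq_of_contDiff hχ hγ (hZ.curve x) (by rw [h0, hZ.zero])]

/-- The inner set consists of the points whose backward trajectory stays in the sublevel set
for the time `ε`. -/
theorem innerSet_sublevel (hχ : ContDiff ℝ 1 χ) (hZ : IsFlowOf χ Z) (hκ : ContDiff ℝ 1 κ)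
    (ht : ∀ z, κ z = 0 → fderiv ℝ κ z (χ z) < 0) {ε : ℝ} (hε : 0 < ε) :
    innerSet {z | κ z < 0} χ ε = {z | κ (Z (-ε) z) < 0} := by
  ext z
  simp only [innerSet, flowLayer, frontier_sublevel hZ hκ ht, flowsTo_iff hχ hZ, mem_inter_iff,
    mem_compl_iff, mem_ofPred_eq, not_exists, not_and]
  refine ⟨fun ⟨hz, hn⟩ => ?_, fun hz => ⟨?_, ?_⟩⟩
  -- Otherwise `κ` vanishes somewhere on the backward trajectory within time `ε`, which puts `z` in
  -- the flow layer.
  · by_contra! h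
    have hc : ContinuousOn (fun t => κ (Z t z)) (Icc (-ε) 0) :=
      (hκ.continuous.comp (hZ.curve z).continuous).continuousOn
    obtain ⟨t, ht', h0⟩ := intermediate_value_Icc' (neg_nonpos.2 hε.le) hc
      (show (0 : ℝ) ∈ Icc _ _ from ⟨by simpa [hZ.zero] using hz.le, h⟩)
    refine hn (-t) ⟨by linarith [ht'.2], by linarith [ht'.1]⟩ (Z t z) h0 ?_
    rw [hZ.neg_apply]
  · simpa [hZ.apply_neg] using flow_neg_of_neg hZ hκ ht hz hε.le
  · rintro t ⟨ht0, htε⟩ x hx rfl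
    have h := flow_neg_of_neg hZ hκ ht hz (sub_nonneg.2 htε)
    rw [← hZ.add, ← hZ.add, show ε - t + -ε + t = 0 by ring, hZ.zero] at h
    exact h.ne hx

/-- The inner set is the preimage of the sublevel set under the homeomorphism `Z (-ε)`, so `Z ε`
matches the two frontiers, moving each point by at most `ε * C`. -/
theorem hausdorffEDist_frontier_innerSet_le (hχ : ContDiff ℝ 1 χ) (hZ : IsFlowOf χ Z)
    (hZc : ∀ t, Continuous (Z t)) (hκ : ContDiff ℝ 1 κ)
    (ht : ∀ z, κ z = 0 → fderiv ℝ κ z (χ z) < 0) {ε : ℝ} (hε : 0 < ε) {C : ℝ}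
    (hC : ∀ z, ‖χ z‖ ≤ C) :
    Metric.hausdorffEDist (frontier (innerSet {z | κ z < 0} χ ε)) (frontier {z | κ z < 0}) ≤
      ENNReal.ofReal (ε * C) := by
  let e : EuclideanSpace ℝ (Fin m) ≃ₜ EuclideanSpace ℝ (Fin m) :=
    { toFun := Z (-ε)
      invFun := Z ε
      left_inv := hZ.apply_neg ε
      right_inv := hZ.neg_apply ε
      continuous_toFun := hZc _
      continuous_invFun := hZc _ }
  have hfr : frontier (innerSet {z | κ z < 0} χ ε) = Z (-ε) ⁻¹' frontier {z | κ z < 0} := by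
    rw [innerSet_sublevel hχ hZ hκ ht hε]
    exact (e.preimage_frontier {z | κ z < 0}).symm
  have hdist : ∀ (t : ℝ) x, |t| = ε → edist x (Z t x) ≤ ENNReal.ofReal (ε * C) := fun t x hts => by
    rw [edist_comm, edist_dist, dist_eq_norm, mul_comm, ← hts]
    exact ENNReal.ofReal_le_ofReal (hZ.norm_sub_le hC t x)
  rw [hfr]
  refine Metric.hausdorffEDist_le_of_mem_edist (fun x hx => ⟨Z (-ε) x, hx, hdist _ _ ?_⟩)
    fun x hx => ⟨Z ε x, ?_, hdist _ _ (abs_of_pos hε)⟩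
  · rw [abs_neg, abs_of_pos hε]
  · rwa [mem_preimage, hZ.neg_apply]

/-- There is a smooth function with values in `[0, 1]` which vanishes exactly off the sublevel
set and equals `1` on the inner set. -/
theorem exists_smooth_cutoff (hZ : IsFlowOf χ Z) (hZc : ∀ t, Continuous (Z t))
    (hκ : ContDiff ℝ 1 κ) (ht : ∀ z, κ z = 0 → fderiv ℝ κ z (χ z) < 0) {ε : ℝ} (hε : 0 < ε)
    (s : ℕ∞) : ∃ g : EuclideanSpace ℝ (Fin m) → ℝ, ContDiff ℝ s g ∧ (∀ z, 0 ≤ g z ∧ g z ≤ 1) ∧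
      (∀ z, g z = 0 ↔ 0 ≤ κ z) ∧ ∀ z, κ (Z (-ε) z) < 0 → g z = 1 := by
  obtain ⟨g, hg, hr, h0, h1⟩ := exists_contMDiff_zero_iff_one_iff_of_isClosed (n := s)
    𝓘(ℝ, EuclideanSpace ℝ (Fin m)) (s := {z | 0 ≤ κ z}) (t := {z | κ (Z (-ε) z) ≤ 0})
    (isClosed_le continuous_const hκ.continuous)
    (isClosed_le (hκ.continuous.comp (hZc _)) continuous_const)
    -- The cutoff needs closed sets, hence `≤ 0`; flowing for the positive time `ε` makes the
    -- inequality strict again.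
    (Set.disjoint_left.2 fun z hz hz' => by
      have := flow_neg_of_nonpos hZ hκ ht hz' hε
      rw [hZ.apply_neg] at this
      exact absurd hz (not_le.2 this))
  exact ⟨g, hg.contDiff, fun z => hr (mem_range_self z), fun z => (h0 z).symm,
    fun z hz => (h1 z).1 hz.le⟩

/-- A positive factor which is eventually `1` along a trajectory does not prevent
the reparametrized trajectory from reaching any later time. -/
theorem exists_le_reparametrization {a θ : ℝ → ℝ} (ha : Continuous a) {ε : ℝ} (hε : 0 < ε)
    (ha0 : ∀ τ, 0 ≤ a τ) (hpos : ∀ τ, 0 ≤ τ → 0 < a τ) (h1 : ∀ τ, ε ≤ τ → a τ = 1)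
    (h0 : θ 0 = 0) (hθ : ∀ t, HasDerivAt θ (a (θ t)) t) : ∃ t, 0 ≤ t ∧ ε ≤ θ t := by
  have hmono : Monotone θ := monotone_of_deriv_nonneg (fun t => (hθ t).differentiableAt)
    fun t => by rw [(hθ t).deriv]; exact ha0 _
  -- The minimum of `a` on `[0, ε]` bounds `a` below on all of `[0, ∞)`, so `θ` reaches `ε` by time
  -- `ε / a τ₀`.
  obtain ⟨τ₀, hτ₀, hmin⟩ := isCompact_Icc.exists_isMinOn (nonempty_Icc.2 hε.le) ha.continuousOn
  have hc := hpos τ₀ hτ₀.1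
  have hle : ∀ τ, 0 ≤ τ → a τ₀ ≤ a τ := fun τ hτ => by
    rcases le_total τ ε with h | h
    · exact hmin ⟨hτ, h⟩
    · rw [h1 τ h, ← h1 ε le_rfl]
      exact hmin (right_mem_Icc.2 hε.le)
  have ht : 0 ≤ ε / a τ₀ := by positivity
  refine ⟨ε / a τ₀, ht, ?_⟩
  have := (convex_Icc 0 (ε / a τ₀)).mul_sub_le_image_sub_of_le_deriv (f := θ) (C := a τ₀)
    (HasDerivAt.continuousOn fun t _ => hθ t)
    (fun t _ => (hθ t).differentiableAt.differentiableWithinAt)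
    (fun t ht => by
      rw [(hθ t).deriv]
      rw [interior_Icc] at ht
      exact hle _ (h0 ▸ hmono ht.1.le))
    0 (left_mem_Icc.2 ht) _ (right_mem_Icc.2 ht) ht
  rwa [sub_zero, h0, sub_zero, mul_div_cancel₀ _ hc.ne'] at this

/-- `φ` conjugates `Z` to the flow `G` of the slowed field `g • χ`. It remains to see that `Z`
reaches `A` from everywhere, that `G` preserves the sublevel set, and that `G` reaches `A` from
there. -/
theorem exists_diffeo_of_transversal {s : ℕ∞} (hs : 1 ≤ s) (hχ : ContDiff ℝ s χ) {C : ℝ}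
    (hC : ∀ z, ‖χ z‖ ≤ C) (hZ : IsFlowOf χ Z) (hZs : ∀ t, ContDiff ℝ s (Z t))
    (hκ : ContDiff ℝ 1 κ) (ht : ∀ z, κ z = 0 → fderiv ℝ κ z (χ z) < 0)
    (hattr : ∀ z, ∃ t, 0 ≤ t ∧ κ (Z t z) < 0) {ε : ℝ} (hε : 0 < ε) :
    ∃ φ : EuclideanSpace ℝ (Fin m) → EuclideanSpace ℝ (Fin m), IsDiffeoOnto s φ {z | κ z < 0} ∧
      (∀ z, ∃ t : ℝ, φ z = Z t z) ∧ ∀ z, κ (Z (-ε) z) < 0 → φ z = z := by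
  have hs' : (1 : WithTop ℕ∞) ≤ s := by exact_mod_cast hs
  have hχ1 : ContDiff ℝ 1 χ := hχ.of_le hs'
  have hZc : ∀ t, Continuous (Z t) := fun t => (hZs t).continuous
  obtain ⟨g, hg, hg01, hg0, hg1⟩ := exists_smooth_cutoff hZ hZc hκ ht hε s
  have hgn : ∀ z, ‖g z‖ ≤ 1 := fun z => by
    rw [Real.norm_of_nonneg (hg01 z).1]
    exact (hg01 z).2
  have hgχ : ContDiff ℝ s fun z => g z • χ z := hg.smul hχ
  have hgχ1 : ContDiff ℝ 1 fun z => g z • χ z := hgχ.of_le hs'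
  obtain ⟨G, hG, hGs⟩ := exists_flow_of_bounded hs hgχ (C := C) fun z => by
    rw [norm_smul]
    exact (mul_le_of_le_one_left (norm_nonneg _) (hgn z)).trans (hC z)
  have hrep := exists_reparametrization hχ1 (hg.of_le hs') ⟨1, hgn⟩ hZ hG
  set A : Set (EuclideanSpace ℝ (Fin m)) := {z | κ (Z (-ε) z) < 0} with hAdef
  have hAo : IsOpen A := isOpen_lt (hκ.continuous.comp (hZc _)) continuous_const
  have hAE : ∀ z ∈ A, κ z < 0 := fun z hz => by
    simpa [hZ.apply_neg] using flow_neg_of_neg hZ hκ ht hz hε.le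
  have hAinv : ∀ z ∈ A, ∀ t, 0 ≤ t → Z t z ∈ A := fun z hz t h0 => by
    have := flow_neg_of_neg hZ hκ ht hz h0
    rwa [← hZ.add, add_comm, hZ.add] at this
  have hA : ∀ z ∈ A, ∀ t, 0 ≤ t → Z t z ∈ A ∧ Z t z = G t z := fun z hz t h0 => by
    refine ⟨hAinv z hz t h0, ?_⟩
    refine eqOn_Icc_of_hasDerivWithinAt (T := t) hgχ1 (hZ.curve z).continuous
      (hG.curve z).continuous (fun τ hτ => ?_) (fun τ _ => (hG.curve z τ).hasDerivWithinAt)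
      (by rw [hZ.zero, hG.zero]) ⟨h0, le_rfl⟩
    rw [hg1 _ (hAinv z hz τ hτ.1), one_smul]
    exact (hZ.curve z τ).hasDerivWithinAt
  have hA' : ∀ z ∈ A, ∀ t, 0 ≤ t → G t z ∈ A ∧ G t z = Z t z := fun z hz t h0 => by
    obtain ⟨h1, h2⟩ := hA z hz t h0
    exact ⟨h2 ▸ h1, h2.symm⟩
  have hZA : ∀ z, ∃ t, 0 ≤ t ∧ Z t z ∈ A := fun z => by
    obtain ⟨t, h0, h⟩ := hattr z
    refine ⟨ε + t, by positivity, ?_⟩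
    rwa [hAdef, mem_ofPred_eq, hZ.add, hZ.neg_apply]
  -- Points with `0 ≤ κ` are equilibria of `g • χ`; by uniqueness no other trajectory meets them, in
  -- either time direction.
  have hGE : ∀ z, κ z < 0 → ∀ t, κ (G t z) < 0 := fun z hz t => by
    by_contra! h
    have hcst : IsIntegralCurve (fun _ : ℝ => G t z) fun _ z => g z • χ z :=
      isIntegralCurve_const fun _ => by rw [(hg0 _).2 h, zero_smul]
    have := congrFun (IsIntegralCurve.eq_of_contDiff hgχ1 (hG.curve (G t z)) hcst
      (hG.zero _)) (-t)
    rw [hG.neg_apply] at this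
    rw [← this] at h
    exact absurd hz (not_lt.2 h)
  have hGA : ∀ z, κ z < 0 → ∃ t, 0 ≤ t ∧ G t z ∈ A := fun z hz => by
    obtain ⟨θ, h0, hθ, hGθ⟩ := hrep z
    have hmem : ∀ τ, ε ≤ τ → Z τ z ∈ A := fun τ hτ => by
      rw [hAdef, mem_ofPred_eq, ← hZ.add]
      exact flow_neg_of_neg hZ hκ ht hz (by linarith)
    obtain ⟨t, ht0, hle⟩ := exists_le_reparametrization (a := fun τ => g (Z τ z))
      (hg.continuous.comp (hZ.curve z).continuous) hε (fun τ => (hg01 _).1)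
      (fun τ hτ => (hg01 _).1.lt_of_ne' fun h =>
        ((hg0 _).1 h).not_gt (flow_neg_of_neg hZ hκ ht hz hτ))
      (fun τ hτ => hg1 _ (hmem τ hτ)) h0 hθ
    exact ⟨t, ht0, by rw [hGθ]; exact hmem _ hle⟩
  refine ⟨flowConj Z G A, ⟨?_, fun z => ?_, flowConj G Z A, ?_, fun z => ?_, fun z hz => ?_⟩,
    fun z => ?_, fun z hz => flowConj_eq_self hZ hG hA hz⟩
  · refine contDiff_iff_contDiffAt.2 fun z => ?_
    obtain ⟨t, h0, h⟩ := hZA z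
    exact contDiffAt_flowConj hZ hG hA hZs hGs hAo h0 h
  · obtain ⟨t, h0, h⟩ := hZA z
    rw [flowConj_eq hZ hG hA h0 h]
    exact hGE _ (hAE _ h) _
  · intro z hz
    obtain ⟨t, h0, h⟩ := hGA z hz
    exact (contDiffAt_flowConj hG hZ hA' hGs hZs hAo h0 h).contDiffWithinAt
  · obtain ⟨t, h0, h⟩ := hZA z
    exact flowConj_flowConj hZ hG hA h0 h
  · obtain ⟨t, h0, h⟩ := hGA z hz
    exact flowConj_flowConj hG hZ hA' h0 h
  · obtain ⟨t, h0, h⟩ := hZA z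
    obtain ⟨θ, -, -, hGθ⟩ := hrep (Z t z)
    -- Going back along `G` is moving along `Z` with the changed clock `θ`.
    exact ⟨θ (-t) + t, by rw [flowConj_eq hZ hG hA h0 h, hGθ, hZ.add]⟩

end ConditionB

theorem lemma1 {m : ℕ} (E : Set (EuclideanSpace ℝ (Fin m))) (hE : IsOpen E)
    (hE_ne : E ≠ Set.univ) (s : ℕ∞) (hs : 1 ≤ s)
    (χ : EuclideanSpace ℝ (Fin m) → EuclideanSpace ℝ (Fin m)) (hχ : ContDiff ℝ s χ)
    (hB : ConditionB E χ) (ε : ℝ) (hε : 0 < ε) :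
    (∃ φ : EuclideanSpace ℝ (Fin m) → EuclideanSpace ℝ (Fin m),
      IsDiffeoOnto s φ E ∧
      (∀ z, ∃ t : ℝ, FlowsTo χ t z (φ z)) ∧
      ∀ z ∈ innerSet E χ ε, φ z = z) ∧
    Metric.hausdorffEDist (frontier (innerSet E χ ε)) (frontier E) ≤
      ENNReal.ofReal (ε * ⨆ z, ‖χ z‖) := by
  obtain ⟨hχ1, ⟨C, hC⟩, κ, K₀, hκ, -, hK, rfl, hattr, ht⟩ := hB
  obtain ⟨Z, hZ, hZs⟩ := exists_flow_of_bounded hs hχ hC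
  refine ⟨?_, hausdorffEDist_frontier_innerSet_le hχ1 hZ (fun t => (hZs t).continuous) hκ ht hε
    fun z => le_ciSup (f := fun z => ‖χ z‖) ⟨C, Set.forall_mem_range.2 hC⟩ z⟩
  -- Attractivity is applied with the neighbourhood `E` of `K₀` itself.
  obtain ⟨φ, h1, h2, h3⟩ := exists_diffeo_of_transversal hs hχ hC hZ hZs hκ ht
    (fun z => ((Filter.eventually_ge_atTop 0).and (hattr _ (hZ.curve z) _ hE hK)).exists) hε
  refine ⟨φ, h1, fun z => ?_, fun z hz => h3 z ?_⟩
  · obtain ⟨t, h⟩ := h2 z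
    exact ⟨t, (flowsTo_iff hχ1 hZ).2 h.symm⟩
  · rwa [innerSet_sublevel hχ1 hZ hκ ht hε] at hz
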